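/- Let $k\ge 1$ and $m\ge 1$ be integers, let $d$ be the Euclidean distance on $\mathbb R^m$, let $c_1,\dots,c_k\in\mathbb R^m$ and let $B_i:=\{x : d(x,c_i)\le 1\}$. For each $i$ let $\mu_i$ be a Borel probability measure on $B_i$ that is invariant under rotations centered in $c_i$ (for $m=1$: under the reflection about $c_i$), that gives positive measure to every relatively open subset of $B_i$ containing $c_i$, and that gives measure zero to every subset of $B_i$ of Lebesgue measure zero. Assume that $E_i:=\int d(x,c_i)\,d\mu_i(x)$ takes the same value for all $i$. For every $n\ge 1$, draw independent points $x^{(i)}_\ell$, $i\in\{1,\dots,k\}$, $\ell\in\{1,\dots,n\}$, with $x^{(i)}_\ell$ distributed according to $\mu_i$, and let $P$ be the family of these $kn$ points. The linear program (LP) is: minimize $\sum_{p,q\in P} d(p,q)z_{pq}$ subject to $\sum_{p\in P}z_{pq}=1$ for all $q\in P$, $z_{pq}\le y_p$ for all $p,q\in P$, $\sum_{p\in P}y_p=k$, and $y_p,z_{pq}\ge 0$ for all $p,q\in P$. It achieves exact recovery if it has a unique optimal solution, all entries $y_p,z_{pq}$ of this solution are in $\{0,1\}$, and the solution assigns each point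 to the ball from which it is drawn, i.e. $z_{pq}=1$ implies that $p$ and $q$ are drawn from the same ball. For $z\in\mathbb R^m$ and $\alpha\in\mathbb R^k$ let $$G^\alpha(z):=\frac1n\,\mathbb E\sum_{i=1}^k\sum_{\ell=1}^n\bigl(\alpha_i-d(z,x^{(i)}_\ell)\bigr)_+ ,$$ where $t_+=\max\{t,0\}$; this does not depend on $n$. Suppose that some $\alpha'\in\mathbb R$ satisfies $1<\alpha'<\min_{i\ne j}d(c_i,c_j)-1$ (for $k=1$ only $1<\alpha'$ is required) and that, for $\alpha:=(\alpha',\dots,\alpha')$ and for every $i$, $c_i$ is the unique point that achieves $\max\{G^\alpha(z) : z\in B_i\}$. If $m\ge 2$, then (LP) achieves exact recovery with high probability: for every $\delta\in(0,1)$ there is $N>0$ such that for every $n>N$ the probability of exact recovery is greater than $1-\delta$. If $m=1$, the same holds with $n$ restricted to odd numbers, i.e. for every $\delta\in(0,1)$ there is $N>0$ such that for every odd $n>N$ the probability of exact recovery is greater than $1-\delta$. -/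

import Mathlib

open MeasureTheory Metric

noncomputable section

namespace KMedian

/-! ### The linear program and the integer program -/

/-- Objective value `∑_{p,q} d(p,q) z_{pq}` of the `k`-median programs. -/
def objective {ι : Type*} [Fintype ι] (d : ι → ι → ℝ) (z : ι → ι → ℝ) : ℝ :=
  ∑ p, ∑ q, d p q * z p q

/-- Feasibility for the linear programming relaxation of the `k`-median problem. -/
structure LPFeasible {ι : Type*} [Fintype ι] (k : ℕ) (y : ι → ℝ) (z : ι → ι → ℝ) : Prop where
  assign : ∀ q, ∑ p, z p q = 1
  le_open : ∀ p q, z p q ≤ y p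
  card : ∑ p, y p = k
  y_nonneg : ∀ p, 0 ≤ y p
  z_nonneg : ∀ p q, 0 ≤ z p q

/-- Feasibility for the integer program of the `k`-median problem. -/
structure IPFeasible {ι : Type*} [Fintype ι] (k : ℕ) (y : ι → ℝ) (z : ι → ι → ℝ) : Prop where
  assign : ∀ q, ∑ p, z p q = 1
  le_open : ∀ p q, z p q ≤ y p
  card : ∑ p, y p = k
  y_binary : ∀ p, y p = 0 ∨ y p = 1
  z_binary : ∀ p q, z p q = 0 ∨ z p q = 1

/-- `(y, z)` is an optimal solution of the linear program with distances `d`. -/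
def LPOptimal {ι : Type*} [Fintype ι] (k : ℕ) (d : ι → ι → ℝ) (y : ι → ℝ) (z : ι → ι → ℝ) :
    Prop :=
  LPFeasible k y z ∧
    ∀ (y' : ι → ℝ) (z' : ι → ι → ℝ), LPFeasible k y' z' → objective d z ≤ objective d z'

/-- The linear program achieves exact recovery on the data points `x p`, `p : ι`, where the point
`x p` is drawn from the ball number `ball p`: there is a unique optimal solution, it is feasible
for the integer program, and it assigns each point to (a center in) the ball it is drawn from. -/
def ExactRecovery {ι X : Type*} [Fintype ι] [PseudoMetricSpace X] {k : ℕ} (ball : ι → Fin k)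
    (x : ι → X) : Prop :=
  ∃ (y : ι → ℝ) (z : ι → ι → ℝ),
    LPOptimal k (fun p q => dist (x p) (x q)) y z ∧
    (∀ (y' : ι → ℝ) (z' : ι → ι → ℝ),
      LPOptimal k (fun p q => dist (x p) (x q)) y' z' → y' = y ∧ z' = z) ∧
    IPFeasible k y z ∧
    ∀ p q, z p q = 1 → ball p = ball q

/-! ### Probability measures on balls -/

/-- `ℝ^m` with the Euclidean distance. -/
abbrev Space (m : ℕ) : Type := EuclideanSpace ℝ (Fin m)

/-- `μ` is a probability measure on the closed ball with center `c` and radius `r`. -/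
structure IsBallMeasure {m : ℕ} (μ : Measure (Space m)) (c : Space m) (r : ℝ) : Prop where
  prob : IsProbabilityMeasure μ
  supported : μ (closedBall c r)ᶜ = 0

/-- `μ` is invariant under rotations (linear isometries) centered in `c`.
In dimension `1` this is the symmetry of `μ` about `c`. -/
def RotationInvariant {m : ℕ} (μ : Measure (Space m)) (c : Space m) : Prop :=
  ∀ f : Space m ≃ₗᵢ[ℝ] Space m, μ.map (fun x => c + f (x - c)) = μ

/-- Every (relatively) open subset of the ball that contains the center has positive measure. -/
def PositiveNearCenter {m : ℕ} (μ : Measure (Space m)) (c : Space m) (r : ℝ) : Prop :=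
  ∀ U : Set (Space m), IsOpen U → c ∈ U → 0 < μ (U ∩ closedBall c r)

/-- Every subset of the ball with zero Lebesgue measure has zero probability. -/
def NullOnLebesgueNull {m : ℕ} (μ : Measure (Space m)) (c : Space m) (r : ℝ) : Prop :=
  ∀ s : Set (Space m), s ⊆ closedBall c r → volume s = 0 → μ s = 0

/-- The mean distance `E d(x, c)` to `c` of a random vector `x` drawn according to `μ`. -/
def meanDist {m : ℕ} (μ : Measure (Space m)) (c : Space m) : ℝ :=
  ∫ x, dist x c ∂μ

/-! ### The extended stochastic ball model -/

/-- Indices of the data points: `⟨i, ℓ⟩` is the `ℓ`-th of the `N i` points of ball `i`. -/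
abbrev SampleIndex {k : ℕ} (N : Fin k → ℕ) : Type := Σ i : Fin k, Fin (N i)

/-- Joint law of the independent points `x ⟨i, ℓ⟩`, where `x ⟨i, ℓ⟩` is drawn according to
`μ i`. -/
def sampleLaw {k m : ℕ} (μ : Fin k → Measure (Space m)) (N : Fin k → ℕ) :
    Measure (SampleIndex N → Space m) :=
  Measure.pi (fun p => μ p.1)

/-- The contribution function `C^a(z) = ∑_i ∑_ℓ (a_i - d(z, x_ℓ^{(i)}))_+`. -/
def contribution {k m : ℕ} {N : Fin k → ℕ} (a : Fin k → ℝ) (x : SampleIndex N → Space m)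
    (z : Space m) : ℝ :=
  ∑ i : Fin k, ∑ l : Fin (N i), max (a i - dist z (x ⟨i, l⟩)) 0

/-- `G^a(z) = (1/n) E C^a(z)`, for the model with parameter `n` and sample sizes `N i`. -/
def G {k m : ℕ} (μ : Fin k → Measure (Space m)) (n : ℕ) (N : Fin k → ℕ) (a : Fin k → ℝ)
    (z : Space m) : ℝ :=
  (1 / (n : ℝ)) * ∫ x, contribution a x z ∂(sampleLaw μ N)

/-- `c` is the unique point that achieves the maximum of `f` on `s`. -/
def IsUniqueMax {X : Type*} (f : X → ℝ) (s : Set X) (c : X) : Prop :=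
  c ∈ s ∧ (∀ z ∈ s, f z ≤ f c) ∧ ∀ z ∈ s, (∀ w ∈ s, f w ≤ f z) → z = c

/-- The events `A n` happen with high probability as `n` tends to infinity within `S`. An event
that is not known to be measurable is required to contain a measurable event of probability more
than `1 - δ`. With `S = Set.univ` this is the usual notion. -/
def WithHighProbability (S : Set ℕ) {Ω : ℕ → Type*} [∀ n, MeasurableSpace (Ω n)]
    (ℙ : ∀ n, Measure (Ω n)) (A : ∀ n, Set (Ω n)) : Prop :=
  ∀ δ : ℝ, 0 < δ → δ < 1 → ∃ n₀ : ℕ, ∀ n ∈ S, n₀ < n →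
    ∃ B : Set (Ω n), MeasurableSet B ∧ B ⊆ A n ∧ 1 - δ < (ℙ n).real B

end KMedian

end

/-!
The linear program is certified by a dual solution in which all points of ball `i` have the same
price `a i`. The contribution `C^a(p)` of a point `p` is what it collects at these prices, and the
certificate asks for a value `λ` that is collected exactly by one point `p_i` of each ball, all
other points collecting less, while `p_i` reaches its own ball and strictly misses the others. By
complementary slackness the assignment of each ball to `p_i` is then the only optimal solution
(`exactRecovery_of_dual`).

Let `E` be the common mean distance to the center. The value `λ = n (α' - E)` and the prices
`a i = α' - E + OPT_i / n`, where `OPT_i` is the cost of the medoid of ball `i`, make the medoids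
collect exactly `λ`. With high probability `C^α / n` is uniformly close to its mean
`meanContribution` on the balls (`whp_contribution_close`) and each ball has a sample point close to
its center (`whp_exists_dist_le`), so that `OPT_i / n` is close to `E` and the prices are close to
`α'`. Points away from the centers collect less than `λ`, since the mean is maximal only at the
centers. A point close to the center of ball `i` reaches exactly ball `i`, so that it collects
`n a i` minus its cost, which is `λ` only if the point is a medoid
(`exactRecovery_of_contribution_close`).

It remains to see that the medoids are almost surely unique. For `m ≥ 2`, two costs agree only if a
third sample point lies on a certain sheet of a hyperboloid, which is a null set
(`volume_dist_sub_dist_eq`, `ae_hasUniqueMedoids_of_two_le`). For `m = 1` the costs of distinct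
points can agree, but an odd number of reals has only one median (`le_of_sum_abs_sub_minimal`).
-/

namespace KMedian

/-! ### Optimality and uniqueness from a dual certificate -/

/-- The duality gap of a feasible solution, for the dual solution with prices `b q` and value `lam`,
is a sum of complementary slackness terms. They are nonnegative if no point `p` collects more than
`lam`. -/
lemma objective_eq_dual_add_gap {ι : Type*} [Fintype ι] {k : ℕ} {y : ι → ℝ} {z : ι → ι → ℝ}
    (d : ι → ι → ℝ) (b : ι → ℝ) (lam : ℝ) (h : LPFeasible k y z) :
    objective d z = (∑ q, b q - k * lam) +
      (∑ p, y p * (lam - ∑ q, max (b q - d p q) 0) +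
        ∑ p, ∑ q, (max (b q - d p q) 0 * (y p - z p q) +
          (max (b q - d p q) 0 - (b q - d p q)) * z p q)) := by
  have hb : ∑ p, ∑ q, b q * z p q = ∑ q, b q := by
    rw [Finset.sum_comm]
    simp_rw [← Finset.mul_sum, h.assign, mul_one]
  have hy : ∑ p, y p * lam = k * lam := by rw [← Finset.sum_mul, h.card]
  rw [← hb, ← hy, objective, ← Finset.sum_sub_distrib, ← Finset.sum_add_distrib,
    ← Finset.sum_add_distrib]
  refine Finset.sum_congr rfl fun p _ => ?_
  rw [mul_sub, Finset.mul_sum]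
  have : ∑ q, (max (b q - d p q) 0 * (y p - z p q) +
      (max (b q - d p q) 0 - (b q - d p q)) * z p q) =
      ∑ q, y p * max (b q - d p q) 0 + ∑ q, d p q * z p q - ∑ q, b q * z p q := by
    rw [← Finset.sum_add_distrib, ← Finset.sum_sub_distrib]
    exact Finset.sum_congr rfl fun q _ => by ring
  rw [this]
  ring

/-- A dual certificate for exact recovery. All points of ball `i` get the price `a i`; the value
`lam` is collected exactly at the centers `c i`, and each center reaches its own ball but strictly
misses the points of the other balls. Complementary slackness then leaves only one optimal
solution. -/
theorem exactRecovery_of_dual {ι X : Type*} [Fintype ι] [PseudoMetricSpace X] {k : ℕ}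
    (ball : ι → Fin k) (x : ι → X) (a : Fin k → ℝ) (lam : ℝ) (c : Fin k → ι)
    (hc : ∀ i, ball (c i) = i)
    (hlam : ∀ i, ∑ q, max (a (ball q) - dist (x (c i)) (x q)) 0 = lam)
    (hlt : ∀ p, (∀ i, p ≠ c i) → ∑ q, max (a (ball q) - dist (x p) (x q)) 0 < lam)
    (hin : ∀ q, dist (x (c (ball q))) (x q) ≤ a (ball q))
    (hout : ∀ q j, j ≠ ball q → a (ball q) < dist (x (c j)) (x q)) :
    ExactRecovery ball x := by
  classical
  have hmem : ∀ p, (∃ i, p = c i) ↔ c (ball p) = p :=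
    fun p => ⟨fun ⟨i, h⟩ => by rw [h, hc], fun h => ⟨_, h.symm⟩⟩
  have hle : ∀ p, ∑ q, max (a (ball q) - dist (x p) (x q)) 0 ≤ lam := by
    intro p
    by_cases h : ∃ i, p = c i
    · obtain ⟨i, rfl⟩ := h
      exact (hlam i).le
    · exact (hlt p fun i hi => h ⟨i, hi⟩).le
  let y : ι → ℝ := fun p => if c (ball p) = p then 1 else 0
  let z : ι → ι → ℝ := fun p q => if p = c (ball q) then 1 else 0
  have hsupp : ∀ p q, z p q = 1 → p = c (ball q) := by
    intro p q h
    by_contra hne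
    simp [z, hne] at h
  have hcard : ∑ p, y p = k := by
    have : ∀ p, y p = ∑ i, if p = c i then (1 : ℝ) else 0 := by
      intro p
      by_cases h : c (ball p) = p
      · rw [Finset.sum_eq_single (ball p)]
        · simp [y, h]
        · intro i _ hi
          rw [if_neg]
          rintro rfl
          exact hi (hc i).symm
        · simp
      · simp only [y, if_neg h]
        refine (Finset.sum_eq_zero fun i _ => if_neg ?_).symm
        rintro rfl
        exact h (by rw [hc])
    simp_rw [this]
    rw [Finset.sum_comm]
    simp
  have hzy : ∀ p q, z p q ≤ y p := by
    intro p q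
    by_cases h : p = c (ball q)
    · simp [z, y, h, hc]
    · simp only [z, y, if_neg h]
      split_ifs <;> norm_num
  have hybin : ∀ p, y p = 0 ∨ y p = 1 := by
    intro p; simp only [y]; split_ifs <;> simp
  have hzbin : ∀ p q, z p q = 0 ∨ z p q = 1 := by
    intro p q; simp only [z]; split_ifs <;> simp
  have hassign : ∀ q, ∑ p, z p q = 1 := by intro q; simp [z]
  have hfeas : LPFeasible k y z :=
    ⟨hassign, hzy, hcard, fun p => by rcases hybin p with h | h <;> simp [h],
      fun p q => by rcases hzbin p q with h | h <;> simp [h]⟩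
  -- the gap of a feasible solution is a sum of nonnegative terms
  have hA : ∀ {y' : ι → ℝ} {z' : ι → ι → ℝ}, LPFeasible k y' z' → ∀ p,
      0 ≤ y' p * (lam - ∑ q, max (a (ball q) - dist (x p) (x q)) 0) :=
    fun h p => mul_nonneg (h.y_nonneg p) (sub_nonneg.2 (hle p))
  have hB : ∀ {y' : ι → ℝ} {z' : ι → ι → ℝ}, LPFeasible k y' z' → ∀ p q,
      0 ≤ max (a (ball q) - dist (x p) (x q)) 0 * (y' p - z' p q) +
        (max (a (ball q) - dist (x p) (x q)) 0 - (a (ball q) - dist (x p) (x q))) * z' p q :=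
    fun h p q => add_nonneg (mul_nonneg (le_max_right _ _) (sub_nonneg.2 (h.le_open p q)))
      (mul_nonneg (sub_nonneg.2 (le_max_left _ _)) (h.z_nonneg p q))
  -- complementary slackness holds for `(y, z)`, so that it has no gap
  have hgap0 : objective (fun p q => dist (x p) (x q)) z = ∑ q, a (ball q) - k * lam := by
    have hA2 : ∑ p, y p * (lam - ∑ q, max (a (ball q) - dist (x p) (x q)) 0) = 0 := by
      refine Finset.sum_eq_zero fun p _ => ?_
      by_cases h : c (ball p) = p
      · have := hlam (ball p)
        rw [h] at this
        rw [this]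
        ring
      · simp [y, h]
    rw [objective_eq_dual_add_gap _ (fun q => a (ball q)) lam hfeas, hA2,
      add_eq_left, zero_add]
    refine Finset.sum_eq_zero fun p _ => Finset.sum_eq_zero fun q _ => ?_
    by_cases h : p = c (ball q)
    · have h1 : z p q = 1 := by simp [z, h]
      have h2 : y p = 1 := by simp [y, h, hc]
      have h3 := hin q
      rw [← h] at h3
      rw [h1, h2, max_eq_left (sub_nonneg.2 h3)]
      ring
    · have h1 : z p q = 0 := by simp [z, h]
      rw [h1]
      by_cases h' : c (ball p) = p
      · have hne : ball p ≠ ball q := fun e => h (by rw [← e, h'])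
        have h3 := hout q (ball p) hne
        rw [h'] at h3
        rw [max_eq_right (by linarith)]
        ring
      · simp [y, h']
  have hopt : LPOptimal k (fun p q => dist (x p) (x q)) y z := by
    refine ⟨hfeas, fun y' z' h => ?_⟩
    rw [hgap0, objective_eq_dual_add_gap _ (fun q => a (ball q)) lam h]
    have := Finset.sum_nonneg fun p (_ : p ∈ Finset.univ) => hA h p
    have := Finset.sum_nonneg fun p (_ : p ∈ Finset.univ) =>
      Finset.sum_nonneg fun q (_ : q ∈ Finset.univ) => hB h p q
    linarith
  refine ⟨y, z, hopt, ?_, ⟨hassign, hzy, hcard, hybin, hzbin⟩,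
    fun p q h => by rw [hsupp p q h, hc]⟩
  -- a second optimal solution has no gap either, so that all its slackness terms vanish
  rintro y' z' ⟨h, hmin⟩
  have hval := hmin y z hfeas
  rw [hgap0, objective_eq_dual_add_gap _ (fun q => a (ball q)) lam h] at hval
  have hA0 := Finset.sum_nonneg fun p (_ : p ∈ Finset.univ) => hA h p
  have hB0 := Finset.sum_nonneg fun p (_ : p ∈ Finset.univ) =>
    Finset.sum_nonneg fun q (_ : q ∈ Finset.univ) => hB h p q
  have hA1 := (Finset.sum_eq_zero_iff_of_nonneg fun p _ => hA h p).1
    (le_antisymm (by linarith) hA0)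
  have hB1 := (Finset.sum_eq_zero_iff_of_nonneg fun p _ =>
    Finset.sum_nonneg fun q (_ : q ∈ Finset.univ) => hB h p q).1 (le_antisymm (by linarith) hB0)
  have hy0 : ∀ p, c (ball p) ≠ p → y' p = 0 := by
    intro p hp
    have := hlt p fun i hi => hp ((hmem p).1 ⟨i, hi⟩)
    exact (mul_eq_zero.1 (hA1 p (Finset.mem_univ _))).resolve_right (by linarith)
  have hz0 : ∀ p q, p ≠ c (ball q) → z' p q = 0 := by
    intro p q hpq
    by_cases hp : c (ball p) = p
    · have hne : ball p ≠ ball q := fun e => hpq (by rw [← e, hp])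
      have h3 := hout q (ball p) hne
      rw [hp] at h3
      have h4 := (Finset.sum_eq_zero_iff_of_nonneg fun q _ => hB h p q).1
        (hB1 p (Finset.mem_univ _)) q (Finset.mem_univ _)
      rw [max_eq_right (by linarith)] at h4
      have : (dist (x p) (x q) - a (ball q)) * z' p q = 0 := by linarith
      exact (mul_eq_zero.1 this).resolve_left (by linarith)
    · have := h.le_open p q
      rw [hy0 p hp] at this
      exact le_antisymm this (h.z_nonneg p q)
  have hz1 : ∀ q, z' (c (ball q)) q = 1 := by
    intro q
    rw [← h.assign q]
    exact (Finset.sum_eq_single _ (fun p _ hp => hz0 p q hp) (by simp)).symm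
  have hy1 : ∀ p, y p ≤ y' p := by
    intro p
    by_cases hp : c (ball p) = p
    · have := h.le_open (c (ball p)) p
      rw [hz1 p, hp] at this
      simpa [y, hp] using this
    · simpa [y, hp] using h.y_nonneg p
  constructor
  · have := (Finset.sum_eq_sum_iff_of_le fun p _ => hy1 p).1 (by rw [hcard, h.card])
    exact funext fun p => (this p (Finset.mem_univ _)).symm
  · funext p q
    by_cases hp : p = c (ball q)
    · rw [hp, hz1]; simp [z]
    · rw [hz0 p q hp]; simp [z, hp]

/-! ### Almost sure uniqueness of the medoid -/

/-- Fubini in one coordinate: a measurable set of the product space all of whose slices in direction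
`r` are null is null. -/
lemma measure_pi_eq_zero_of_slices {ι : Type*} [Fintype ι] [DecidableEq ι] {X : ι → Type*}
    [∀ i, MeasurableSpace (X i)] (μ : ∀ i, Measure (X i)) [∀ i, SigmaFinite (μ i)]
    {s : Set (∀ i, X i)} (hs : MeasurableSet s) (r : ι)
    (h : ∀ x, μ r {t | Function.update x r t ∈ s} = 0) : Measure.pi μ s = 0 := by
  rw [← lintegral_indicator_one hs, ← lintegral_zero (μ := Measure.pi μ)]
  refine lintegral_eq_of_lmarginal_eq {r} (measurable_one.indicator hs) measurable_zero ?_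
  funext x
  rw [lmarginal_singleton, lmarginal_singleton]
  beta_reduce
  rw [lintegral_zero, ← h x]
  change _ = μ r (Function.update x r ⁻¹' s)
  rw [← lintegral_indicator_one ((measurable_update x) hs)]
  rfl

/-- Along a line in direction `w`, not through the origin, the difference of the distances to two
points `0` and `w` is strictly increasing. -/
lemma norm_sub_norm_sub_lt {E : Type*} [NormedAddCommGroup E] [NormedSpace ℝ E]
    [StrictConvexSpace ℝ E] {x w : E} (hw : w ≠ 0) (hx : ∀ b : ℝ, x ≠ b • w) {s t : ℝ}
    (hst : s < t) :
    ‖x + s • w‖ - ‖x + s • w - w‖ < ‖x + t • w‖ - ‖x + t • w - w‖ := by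
  -- `x + s • w` and `x + t • w - w` lie strictly between `P` and `Q`, at mirrored positions
  set P := x + s • w - w with hP
  set Q := x + t • w with hQ
  have hP0 : P ≠ 0 := fun h => hx (1 - s) (by
    rw [sub_smul, one_smul, ← sub_eq_zero, ← h, hP]; abel)
  have hQ0 : Q ≠ 0 := fun h => hx (-t) (by rw [neg_smul, ← sub_eq_zero, ← h, hQ]; abel)
  have hcol : ∀ p q : ℝ, p • P ≠ 0 → p • P ≠ q • Q := by
    intro p q hp h
    have h1 : (p - q) • x = (q * t - p * (s - 1)) • w := by
      rw [hP, hQ] at h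
      rw [← sub_eq_zero] at h ⊢
      rw [← h]
      module
    by_cases hpq : p = q
    · rw [hpq, sub_self, zero_smul] at h1
      rcases smul_eq_zero.1 h1.symm with h2 | h2
      · have : q * (t - s + 1) = 0 := by linarith
        rcases mul_eq_zero.1 this with h3 | h3
        · exact hp (by rw [hpq, h3, zero_smul])
        · linarith
      · exact hw h2
    · refine hx ((p - q)⁻¹ * (q * t - p * (s - 1))) ?_
      rw [mul_smul, ← h1, smul_smul, inv_mul_cancel₀ (sub_ne_zero.2 hpq), one_smul]
  have hray : ∀ p q : ℝ, 0 < p → 0 < q → ‖p • P + q • Q‖ < p * ‖P‖ + q * ‖Q‖ := by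
    intro p q hp hq
    have hns : ¬ SameRay ℝ (p • P) (q • Q) := by
      rintro (h | h | ⟨a, b, ha, hb, h⟩)
      · exact smul_ne_zero hp.ne' hP0 h
      · exact smul_ne_zero hq.ne' hQ0 h
      · rw [smul_smul, smul_smul] at h
        exact hcol _ _ (smul_ne_zero (mul_pos ha hp).ne' hP0) h
    simpa [norm_smul, abs_of_pos hp, abs_of_pos hq] using norm_add_lt_of_not_sameRay hns
  have hL : 0 < 1 + (t - s) := by linarith
  have hθ : (1 + (t - s))⁻¹ * (1 + (t - s)) = 1 := inv_mul_cancel₀ hL.ne'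
  have hθ1 : (1 + (t - s))⁻¹ < 1 := inv_lt_one_of_one_lt₀ (by linarith)
  have hθ0 : 0 < (1 + (t - s))⁻¹ := inv_pos.2 hL
  set θ := (1 + (t - s))⁻¹
  have hQP : Q = P + (1 + (t - s)) • w := by rw [hP, hQ]; module
  have h1 := hray (1 - θ) θ (by linarith) hθ0
  have h2 := hray θ (1 - θ) hθ0 (by linarith)
  have e1 : (1 - θ) • P + θ • Q = x + s • w := by
    rw [hQP, smul_add, smul_smul, hθ, hP]; module
  have e2 : θ • P + (1 - θ) • Q = Q - w := by
    rw [hQP, smul_add, smul_smul, sub_mul, hθ]; module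
  rw [e1] at h1
  rw [e2] at h2
  linarith

open scoped Pointwise in
/-- In dimension at least two, each sheet of a hyperboloid with distinct foci `u`, `v` (including
the degenerate cases) is a null set: away from the line through the foci, each line in direction
`v - u` meets it at most once. -/
lemma volume_dist_sub_dist_eq {E : Type*} [NormedAddCommGroup E] [InnerProductSpace ℝ E]
    [FiniteDimensional ℝ E] [MeasurableSpace E] [BorelSpace E] (hE : 1 < Module.finrank ℝ E)
    {u v : E} (huv : u ≠ v) (s : ℝ) :
    volume {x : E | dist u x - dist v x = s} = 0 := by
  have hw : v - u ≠ 0 := sub_ne_zero.2 huv.symm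
  set w := v - u with hwdef
  let L : Submodule ℝ E := Submodule.span ℝ {w}
  let A : AffineSubspace ℝ E := AffineSubspace.mk' u L
  have hA : volume (A : Set E) = 0 := by
    refine Measure.addHaar_affineSubspace _ _ fun h => ?_
    have h1 : A.direction = ⊤ := by rw [h, AffineSubspace.direction_top]
    rw [AffineSubspace.direction_mk'] at h1
    have h2 : Module.finrank ℝ L = 1 := finrank_span_singleton hw
    rw [h1, finrank_top] at h2
    omega
  have hmeas : MeasurableSet {x : E | dist u x - dist v x = s} :=
    (isClosed_eq (by fun_prop) continuous_const).measurableSet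
  have hAm : MeasurableSet (A : Set E) :=
    (AffineSubspace.closed_of_finiteDimensional A).measurableSet
  have hmain : volume ({x : E | dist u x - dist v x = s} \ A) = 0 := by
    let τ : ℕ → ℝ := fun n => 1 / ((n : ℝ) + 1)
    have hτ : Function.Injective τ := by
      intro a b hab
      simpa [τ] using hab
    refine Measure.addHaar_eq_zero_of_disjoint_translates _ (fun n => τ n • w) ?_ ?_
      (hmeas.diff hAm)
    · refine isBounded_iff_forall_norm_le.2 ⟨‖w‖, ?_⟩
      rintro _ ⟨n, rfl⟩
      have h1 : |τ n| ≤ 1 := by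
        rw [abs_of_nonneg (by positivity)]
        exact (div_le_one (by positivity)).2 (by linarith [n.cast_nonneg (α := ℝ)])
      simpa [norm_smul] using mul_le_mul_of_nonneg_right h1 (norm_nonneg w)
    · have key : ∀ a b : ℝ, a < b → Disjoint
          (({a • w} : Set E) + {x : E | dist u x - dist v x = s} \ A)
          (({b • w} : Set E) + {x : E | dist u x - dist v x = s} \ A) := by
        intro a b hab
        rw [Set.disjoint_left]
        rintro _ ⟨_, rfl, x, ⟨hx, hxA⟩, rfl⟩ ⟨_, rfl, y, ⟨hy, -⟩, hxy⟩
        simp only at hxy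
        have hyx : x - u = (y - u) + (b - a) • w := by
          have : x = b • w + y - a • w := by rw [hxy]; abel
          rw [this, sub_smul]; abel
        have hnot : ∀ c : ℝ, y - u ≠ c • w := by
          intro c hc
          apply hxA
          rw [SetLike.mem_coe, AffineSubspace.mem_mk', vsub_eq_sub, hyx, hc, ← add_smul]
          exact Submodule.smul_mem _ _ (Submodule.mem_span_singleton_self w)
        have := norm_sub_norm_sub_lt hw hnot (sub_pos.2 hab)
        rw [← hyx, zero_smul, add_zero] at this
        have e : ∀ z : E, z - u - w = z - v := fun z => by rw [hwdef]; abel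
        rw [e, e] at this
        simp only [Set.mem_ofPred_eq, dist_comm u, dist_comm v, dist_eq_norm] at hx hy
        linarith
      intro i j hij
      rcases lt_or_gt_of_ne (hτ.ne hij) with h | h
      · exact key _ _ h
      · exact (key _ _ h).symm
  refine measure_mono_null (t := ({x : E | dist u x - dist v x = s} \ A) ∪ A) ?_
    (measure_union_null hmain hA)
  rw [Set.sdiff_union_self]
  exact Set.subset_union_left


lemma absolutelyContinuous_volume {m : ℕ} {μ : Measure (Space m)} {c : Space m} {r : ℝ}
    (hμ : IsBallMeasure μ c r) (h : NullOnLebesgueNull μ c r) : μ ≪ volume := by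
  intro s hs
  refine measure_mono_null (t := s ∩ closedBall c r ∪ (closedBall c r)ᶜ) ?_ (measure_union_null
    (h _ Set.inter_subset_right (measure_mono_null Set.inter_subset_left hs)) hμ.supported)
  intro x hx
  by_cases hxc : x ∈ closedBall c r
  · exact Or.inl ⟨hx, hxc⟩
  · exact Or.inr hxc

/-- The sum of the distances of `z` to the sample points of ball `i`. -/
noncomputable def cost {k m n : ℕ} (x : SampleIndex (fun _ : Fin k => n) → Space m) (i : Fin k)
    (z : Space m) : ℝ :=
  ∑ l, dist z (x ⟨i, l⟩)

/-- The sample points of each ball have at most one medoid, i.e. at most one sample index whose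
point minimizes the sum of the distances to the sample points of the ball. -/
def HasUniqueMedoids {k m n : ℕ} (x : SampleIndex (fun _ : Fin k => n) → Space m) : Prop :=
  ∀ i l l', (∀ j, cost x i (x ⟨i, l⟩) ≤ cost x i (x ⟨i, j⟩)) →
    (∀ j, cost x i (x ⟨i, l'⟩) ≤ cost x i (x ⟨i, j⟩)) → l = l'

lemma measurableSet_apply_eq {ι : Type*} [Fintype ι] {m : ℕ} (p q : ι) :
    MeasurableSet {x : ι → Space m | x p = x q} :=
  (isClosed_eq (by fun_prop) (by fun_prop)).measurableSet

lemma ae_sample_ne {k m : ℕ} (hm : 1 ≤ m) (μ : Fin k → Measure (Space m))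
    [∀ i, IsProbabilityMeasure (μ i)] (hac : ∀ i, μ i ≪ volume) (n : ℕ) :
    ∀ᵐ x ∂sampleLaw μ (fun _ => n), ∀ i l l', l ≠ l' → x ⟨i, l⟩ ≠ x ⟨i, l'⟩ := by
  rw [ae_all_iff]; intro i
  rw [ae_all_iff]; intro l
  rw [ae_all_iff]; intro l'
  by_cases hl : l = l'
  · exact Filter.Eventually.of_forall fun x h => absurd hl h
  have : Nonempty (Fin m) := ⟨⟨0, hm⟩⟩
  have hne : (⟨i, l'⟩ : SampleIndex (fun _ : Fin k => n)) ≠ ⟨i, l⟩ := by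
    simpa using Ne.symm hl
  have h0 : sampleLaw μ (fun _ => n) {x | x ⟨i, l⟩ = x ⟨i, l'⟩} = 0 := by
    refine measure_pi_eq_zero_of_slices _ (measurableSet_apply_eq _ _) ⟨i, l⟩ fun x => ?_
    refine hac i (measure_mono_null (t := {x ⟨i, l'⟩}) ?_ (measure_singleton _))
    intro t ht
    simpa [Function.update_of_ne hne] using ht
  filter_upwards [measure_eq_zero_iff_ae_notMem.1 h0] with x hx _ using hx

/-- In dimension at least two, any two points of a sample of at least three points have different
costs: the resampling of a third point moves the difference of the costs off any given value. -/
lemma ae_hasUniqueMedoids_of_two_le {k m : ℕ} (hm : 2 ≤ m) (μ : Fin k → Measure (Space m))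
    [∀ i, IsProbabilityMeasure (μ i)] (hac : ∀ i, μ i ≪ volume) {n : ℕ} (hn : 3 ≤ n) :
    ∀ᵐ x ∂sampleLaw μ (fun _ => n), HasUniqueMedoids x := by
  have key : ∀ i l l', l ≠ l' → ∀ᵐ x ∂sampleLaw μ (fun _ => n),
      ¬ (x ⟨i, l⟩ ≠ x ⟨i, l'⟩ ∧ cost x i (x ⟨i, l⟩) = cost x i (x ⟨i, l'⟩)) := by
    intro i l l' hl
    obtain ⟨r, hr⟩ : ∃ r : Fin n, r ∉ ({l, l'} : Finset (Fin n)) := by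
      by_contra! h
      have h1 : Finset.univ ⊆ ({l, l'} : Finset (Fin n)) := fun r _ => h r
      have h2 := Finset.card_le_card h1
      rw [Finset.card_univ, Fintype.card_fin] at h2
      have := Finset.card_le_two (a := l) (b := l')
      omega
    simp only [Finset.mem_insert, Finset.mem_singleton, not_or] at hr
    have hne : ∀ j, j ≠ r → (⟨i, j⟩ : SampleIndex (fun _ : Fin k => n)) ≠ ⟨i, r⟩ := by
      intro j hj
      simpa using hj
    suffices h0 : sampleLaw μ (fun _ => n) {x | x ⟨i, l⟩ ≠ x ⟨i, l'⟩ ∧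
        cost x i (x ⟨i, l⟩) = cost x i (x ⟨i, l'⟩)} = 0 from measure_eq_zero_iff_ae_notMem.1 h0
    refine measure_pi_eq_zero_of_slices _ (MeasurableSet.inter
      (measurableSet_apply_eq _ _).compl
      (isClosed_eq ?_ ?_).measurableSet) ⟨i, r⟩ fun x => ?_
    · unfold cost; fun_prop
    · unfold cost; fun_prop
    by_cases hx : x ⟨i, l⟩ = x ⟨i, l'⟩
    · convert! measure_empty (μ := μ i)
      ext t
      simp [Function.update_of_ne (hne l (Ne.symm hr.1)),
        Function.update_of_ne (hne l' (Ne.symm hr.2)), hx]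
    refine hac i (measure_mono_null (t := {t | dist (x ⟨i, l⟩) t - dist (x ⟨i, l'⟩) t =
      ∑ j ∈ Finset.univ.erase r, dist (x ⟨i, l'⟩) (x ⟨i, j⟩) -
      ∑ j ∈ Finset.univ.erase r, dist (x ⟨i, l⟩) (x ⟨i, j⟩)}) ?_
      (volume_dist_sub_dist_eq (by rw [finrank_euclideanSpace_fin]; omega) hx _))
    rintro t ⟨-, ht⟩
    have hcost : ∀ z, cost (Function.update x ⟨i, r⟩ t) i z =
        dist z t + ∑ j ∈ Finset.univ.erase r, dist z (x ⟨i, j⟩) := by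
      intro z
      rw [cost, ← Finset.add_sum_erase _ _ (Finset.mem_univ r), Function.update_self]
      congr 1
      exact Finset.sum_congr rfl fun j hj => by
        rw [Function.update_of_ne (hne j (Finset.ne_of_mem_erase hj))]
    rw [hcost, hcost, Function.update_of_ne (hne l (Ne.symm hr.1)),
      Function.update_of_ne (hne l' (Ne.symm hr.2))] at ht
    simp only [Set.mem_ofPred_eq]
    linarith
  have key' : ∀ᵐ x ∂sampleLaw μ (fun _ => n), ∀ i l l', l ≠ l' →
      ¬ (x ⟨i, l⟩ ≠ x ⟨i, l'⟩ ∧ cost x i (x ⟨i, l⟩) = cost x i (x ⟨i, l'⟩)) := by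
    rw [ae_all_iff]; intro i
    rw [ae_all_iff]; intro l
    rw [ae_all_iff]; intro l'
    by_cases hl : l = l'
    · exact Filter.Eventually.of_forall fun x h => absurd hl h
    · filter_upwards [key i l l' hl] with x hx _ using hx
  filter_upwards [key', ae_sample_ne (by omega) μ hac n] with x hx hx' i l l' h h'
  by_contra hl
  exact hx i l l' hl ⟨hx' i l l' hl, le_antisymm (h l') (h' l)⟩

/-- An odd number of reals has only one median value: if `u p` and `u q` both minimize the sum of
the distances to the numbers `u j`, then they agree. The slope of the sum to the right of `u p` is
odd, hence positive, and it does not decrease further to the right. -/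
lemma le_of_sum_abs_sub_minimal {n : ℕ} (hn : Odd n) (u : Fin n → ℝ) {p q : Fin n}
    (hp : ∀ j, ∑ l, |u p - u l| ≤ ∑ l, |u j - u l|)
    (hq : ∀ j, ∑ l, |u q - u l| ≤ ∑ l, |u j - u l|) : u q ≤ u p := by
  classical
  by_contra! hpq
  -- the sample point that follows `u p`
  obtain ⟨s, hs, hsmin⟩ := Finset.exists_min_image (Finset.univ.filter fun j => u p < u j) u
    ⟨q, by simpa using hpq⟩
  simp only [Finset.mem_filter, Finset.mem_univ, true_and] at hs hsmin
  -- a sum of `n` signs is odd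
  have hsign : ∑ l, (if u l ≤ u p then (1 : ℝ) else -1) ≠ 0 := by
    have h1 : ∀ l, (if u l ≤ u p then (1 : ℝ) else -1) =
        ((if u l ≤ u p then (1 : ℤ) else -1 : ℤ) : ℝ) := by
      intro l; split_ifs <;> simp
    simp_rw [h1]
    rw [← Int.cast_sum, Int.cast_ne_zero]
    intro h0
    have h2 := congrArg (fun z : ℤ => (z : ZMod 2)) h0
    have h3 : ∀ l, (((if u l ≤ u p then (1 : ℤ) else -1 : ℤ)) : ZMod 2) = 1 := by
      intro l; split_ifs <;> decide
    simp only [Int.cast_sum, h3, Finset.sum_const, Finset.card_univ, Fintype.card_fin,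
      nsmul_eq_mul, mul_one, Int.cast_zero] at h2
    rw [ZMod.natCast_eq_zero_iff_even] at h2
    exact (Nat.not_even_iff_odd.2 hn) h2
  have hstep : ∑ l, |u s - u l| - ∑ l, |u p - u l| =
      (u s - u p) * ∑ l, (if u l ≤ u p then (1 : ℝ) else -1) := by
    rw [← Finset.sum_sub_distrib, Finset.mul_sum]
    refine Finset.sum_congr rfl fun l _ => ?_
    split_ifs with h
    · rw [abs_of_nonneg (by linarith), abs_of_nonneg (by linarith)]; ring
    · have h' := hsmin l (not_le.1 h)
      rw [abs_of_nonpos (by linarith), abs_of_nonpos (by linarith [not_le.1 h])]; ring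
  have hjump : (u q - u p) * ∑ l, (if u l ≤ u p then (1 : ℝ) else -1) ≤
      ∑ l, |u q - u l| - ∑ l, |u p - u l| := by
    rw [← Finset.sum_sub_distrib, Finset.mul_sum]
    refine Finset.sum_le_sum fun l _ => ?_
    split_ifs with h
    · rw [abs_of_nonneg (by linarith), abs_of_nonneg (by linarith)]; linarith
    · have := abs_sub_abs_le_abs_sub (u p - u l) (u q - u l)
      have h1 : |u p - u l - (u q - u l)| = u q - u p := by
        rw [abs_of_nonpos (by linarith)]; ring
      linarith
  have h1 : 0 ≤ ∑ l, (if u l ≤ u p then (1 : ℝ) else -1) := by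
    refine nonneg_of_mul_nonneg_right (a := u s - u p) ?_ (by linarith)
    rw [← hstep]
    linarith [hp s]
  have h2 := mul_pos (sub_pos.2 hpq) (lt_of_le_of_ne h1 hsign.symm)
  linarith [hq p]

lemma ae_hasUniqueMedoids_of_odd {k : ℕ} (μ : Fin k → Measure (Space 1))
    [∀ i, IsProbabilityMeasure (μ i)] (hac : ∀ i, μ i ≪ volume) {n : ℕ} (hn : Odd n) :
    ∀ᵐ x ∂sampleLaw μ (fun _ => n), HasUniqueMedoids x := by
  filter_upwards [ae_sample_ne le_rfl μ hac n] with x hx i l l' h h'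
  have hcost : ∀ z : Space 1, cost x i z = ∑ j, |z 0 - x ⟨i, j⟩ 0| := by
    intro z
    simp [cost, EuclideanSpace.dist_eq, Real.dist_eq, Real.sqrt_sq_eq_abs]
  simp only [hcost] at h h'
  by_contra hl
  refine hx i l l' hl ?_
  ext j
  rw [Subsingleton.elim j 0]
  exact le_antisymm (le_of_sum_abs_sub_minimal hn (fun j => x ⟨i, j⟩ 0) h' h)
    (le_of_sum_abs_sub_minimal hn (fun j => x ⟨i, j⟩ 0) h h')

/-! ### A deterministic criterion for exact recovery -/

lemma max_sub_zero_le_add {s t u v : ℝ} {e : ℝ} (he : s - u ≤ t - v + e) (h0 : 0 ≤ e) :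
    max (s - u) 0 ≤ max (t - v) 0 + e :=
  max_le (he.trans (by gcongr; exact le_max_left _ _))
    (add_nonneg (le_max_right _ _) h0)

lemma contribution_le_add {k m n : ℕ} (x : SampleIndex (fun _ : Fin k => n) → Space m)
    {a b : Fin k → ℝ} {z w : Space m} {e : ℝ} (h : ∀ i, a i + dist z w ≤ b i + e) (he : 0 ≤ e) :
    contribution a x z ≤ contribution b x w + n * (k * e) := by
  have : (n : ℝ) * (k * e) = ∑ _i : Fin k, ∑ _l : Fin n, e := by
    simp; ring
  rw [this, contribution, contribution, ← Finset.sum_add_distrib]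
  refine Finset.sum_le_sum fun i _ => ?_
  rw [← Finset.sum_add_distrib]
  refine Finset.sum_le_sum fun l _ => max_sub_zero_le_add ?_ he
  have := dist_triangle_left w (x ⟨i, l⟩) z
  linarith [h i]

/-- A point that reaches all sample points of ball `i` and no others contributes the total price
minus the cost. -/
lemma contribution_eq_sub_cost {k m n : ℕ} (x : SampleIndex (fun _ : Fin k => n) → Space m)
    (a : Fin k → ℝ) (z : Space m) (i : Fin k) (hin : ∀ l, dist z (x ⟨i, l⟩) ≤ a i)
    (hout : ∀ j, j ≠ i → ∀ l, a j ≤ dist z (x ⟨j, l⟩)) :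
    contribution a x z = n * a i - cost x i z := by
  rw [contribution, Finset.sum_eq_single i]
  · have : (n : ℝ) * a i = ∑ _l : Fin n, a i := by simp
    rw [this, cost, ← Finset.sum_sub_distrib]
    exact Finset.sum_congr rfl fun l _ => max_eq_left (sub_nonneg.2 (hin l))
  · exact fun j _ hj => Finset.sum_eq_zero fun l _ => max_eq_right (sub_nonpos.2 (hout j hj l))
  · simp

lemma sub_cost_le_contribution {k m n : ℕ} (x : SampleIndex (fun _ : Fin k => n) → Space m)
    (a : Fin k → ℝ) (z : Space m) (i : Fin k) : n * a i - cost x i z ≤ contribution a x z := by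
  have : (n : ℝ) * a i = ∑ _l : Fin n, a i := by simp
  rw [this, cost, ← Finset.sum_sub_distrib]
  refine (Finset.sum_le_sum fun l _ => le_max_left (a i - dist z (x ⟨i, l⟩)) 0).trans ?_
  exact Finset.single_le_sum (f := fun i => ∑ l, max (a i - dist z (x ⟨i, l⟩)) 0)
    (fun j _ => Finset.sum_nonneg fun l _ => le_max_right _ _) (Finset.mem_univ i)

/-- Exact recovery holds for every sample with unique medoids for which the contribution function
is close to `n * g`, where `g` has the same value at all centers `c i` and is smaller by `η` outside
of the `τ`-balls around them, and which has points close to the centers. The dual prices are chosen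
such that each medoid collects exactly `n * g (c i)`. -/
theorem exactRecovery_of_contribution_close {k m n : ℕ} (hn : 0 < n) (c : Fin k → Space m)
    {α' τ η ε G₀ : ℝ} (g : Space m → ℝ) (hε : 0 < ε) (hτ : 1 + 2 * τ ≤ α') (hετ : 2 * ε ≤ τ)
    (hsep : ∀ i j, i ≠ j → α' + 2 * τ ≤ dist (c i) (c j) - 1) (hεη : (2 * k + 1) * ε < η)
    (hgc : ∀ i, g (c i) = G₀) (hg : ∀ i, ∀ z ∈ closedBall (c i) 1, g z ≤ G₀)
    (hgη : ∀ i, ∀ z ∈ closedBall (c i) 1, τ ≤ dist z (c i) → g z ≤ G₀ - η)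
    (x : SampleIndex (fun _ : Fin k => n) → Space m)
    (hx : ∀ p, x p ∈ closedBall (c p.1) 1)
    (hclose : ∀ i, ∀ z ∈ closedBall (c i) 1,
      |contribution (fun _ => α') x z - n * g z| ≤ n * ε)
    (hnear : ∀ i, ∃ l, dist (x ⟨i, l⟩) (c i) ≤ ε) (huniq : HasUniqueMedoids x) :
    ExactRecovery (fun p : SampleIndex (fun _ : Fin k => n) => p.1) x := by
  have hn' : (0 : ℝ) < n := Nat.cast_pos.2 hn
  have : Nonempty (Fin n) := ⟨⟨0, hn⟩⟩
  choose med hmed using fun i => Finite.exists_min fun l => cost x i (x ⟨i, l⟩)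
  let a : Fin k → ℝ := fun i => G₀ + cost x i (x ⟨i, med i⟩) / n
  have ha : ∀ i, n * a i = n * G₀ + cost x i (x ⟨i, med i⟩) := by
    intro i
    simp only [a]
    field_simp
  -- the prices are close to `α'`
  have haα : ∀ i, a i ≤ α' + 2 * ε ∧ α' - 2 * ε ≤ a i := by
    intro i
    constructor
    · obtain ⟨l, hl⟩ := hnear i
      have hci : c i ∈ closedBall (c i) 1 := mem_closedBall_self zero_le_one
      have h1 := (abs_le.1 (hclose i (c i) hci)).1
      rw [hgc, contribution_eq_sub_cost x _ _ i] at h1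
      · have h2 : cost x i (x ⟨i, l⟩) ≤ cost x i (c i) + n * ε := by
          have : (n : ℝ) * ε = ∑ _l : Fin n, ε := by simp
          rw [this, cost, cost, ← Finset.sum_add_distrib]
          refine Finset.sum_le_sum fun j _ => ?_
          have := dist_triangle (x ⟨i, l⟩) (c i) (x ⟨i, j⟩)
          linarith
        refine le_of_mul_le_mul_left ?_ hn'
        rw [ha]
        linarith [hmed i l]
      · intro l'
        have := mem_closedBall'.1 (hx ⟨i, l'⟩)
        dsimp only at this
        linarith
      · intro j hj l'
        have h2 := mem_closedBall.1 (hx ⟨j, l'⟩)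
        have h3 := dist_triangle (c i) (x ⟨j, l'⟩) (c j)
        have h4 := hsep i j hj.symm
        dsimp only at h2
        linarith
    · have hmem := hx ⟨i, med i⟩
      have h1 := (abs_le.1 (hclose i _ hmem)).2
      have h2 := sub_cost_le_contribution x (fun _ => α') (x ⟨i, med i⟩) i
      have h3 := mul_le_mul_of_nonneg_left (hg i _ hmem) hn'.le
      refine le_of_mul_le_mul_left ?_ hn'
      rw [ha]
      dsimp only at h2
      nlinarith [mul_pos hn' hε]
  have hfar : ∀ p, τ ≤ dist (x p) (c p.1) → contribution a x (x p) < n * G₀ := by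
    intro p hp
    have h1 := contribution_le_add x (a := a) (b := fun _ => α') (z := x p) (w := x p)
      (e := 2 * ε) (fun i => by rw [dist_self, add_zero]; exact (haα i).1) (by linarith)
    have h2 := (abs_le.1 (hclose p.1 _ (hx p))).2
    have h3 := mul_le_mul_of_nonneg_left (hgη p.1 _ (hx p) hp) hn'.le
    have h4 := mul_lt_mul_of_pos_left hεη hn'
    nlinarith
  have hin : ∀ p, dist (x p) (c p.1) < τ → ∀ l, dist (x p) (x ⟨p.1, l⟩) ≤ a p.1 := by
    intro p hp l
    have h1 := mem_closedBall'.1 (hx ⟨p.1, l⟩)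
    have h2 := dist_triangle (x p) (c p.1) (x ⟨p.1, l⟩)
    dsimp only at h1
    linarith [(haα p.1).2]
  have hout : ∀ p, dist (x p) (c p.1) < τ → ∀ j, j ≠ p.1 → ∀ l,
      a j < dist (x p) (x ⟨j, l⟩) := by
    intro p hp j hj l
    have h1 := mem_closedBall.1 (hx ⟨j, l⟩)
    have h2 := dist_triangle4 (c p.1) (x p) (x ⟨j, l⟩) (c j)
    have h3 := hsep _ _ hj.symm
    rw [dist_comm (c p.1) (x p)] at h2
    dsimp only at h1
    linarith [(haα j).1]
  have hcontr : ∀ p, dist (x p) (c p.1) < τ →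
      contribution a x (x p) = n * G₀ + cost x p.1 (x ⟨p.1, med p.1⟩) - cost x p.1 (x p) := by
    intro p hp
    rw [contribution_eq_sub_cost x a _ p.1 (hin p hp) fun j hj l => (hout p hp j hj l).le, ha]
  have hmednear : ∀ i, dist (x ⟨i, med i⟩) (c i) < τ := by
    intro i
    by_contra! h
    have h1 := hfar ⟨i, med i⟩ h
    have h2 := sub_cost_le_contribution x a (x ⟨i, med i⟩) i
    rw [ha] at h2
    linarith
  have hsum : ∀ p, ∑ q : SampleIndex (fun _ : Fin k => n),
      max (a q.1 - dist (x p) (x q)) 0 = contribution a x (x p) :=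
    fun p => Fintype.sum_sigma _
  refine exactRecovery_of_dual _ x a (n * G₀) (fun i => ⟨i, med i⟩) (fun _ => rfl) ?_ ?_ ?_ ?_
  · intro i
    rw [hsum, hcontr _ (hmednear i)]
    ring
  · intro p hp
    rw [hsum]
    rcases le_or_gt τ (dist (x p) (c p.1)) with h | h
    · exact hfar p h
    · rw [hcontr p h]
      have : cost x p.1 (x ⟨p.1, med p.1⟩) < cost x p.1 (x p) := by
        by_contra! hle
        have := huniq p.1 p.2 (med p.1) (fun j => hle.trans (hmed _ j)) (hmed _)
        exact hp p.1 (by rw [← this])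
      linarith
  · exact fun q => hin ⟨q.1, med q.1⟩ (hmednear q.1) q.2
  · exact fun q j hj => hout ⟨j, med j⟩ (hmednear j) q.1 hj.symm q.2

/-! ### Events of high probability -/

section WithHighProbability

variable {S : Set ℕ} {Ω : ℕ → Type*} [∀ n, MeasurableSpace (Ω n)] {ℙ : ∀ n, Measure (Ω n)}
  {A A' : ∀ n, Set (Ω n)}

lemma WithHighProbability.mono (h : WithHighProbability S ℙ A) (hAA' : ∀ n, A n ⊆ A' n) :
    WithHighProbability S ℙ A' := by
  intro δ h0 h1
  obtain ⟨n₀, hn₀⟩ := h δ h0 h1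
  refine ⟨n₀, fun n hn hlt => ?_⟩
  obtain ⟨B, hB, hBA, hδ⟩ := hn₀ n hn hlt
  exact ⟨B, hB, hBA.trans (hAA' n), hδ⟩

lemma WithHighProbability.of_ae [∀ n, IsProbabilityMeasure (ℙ n)] (N : ℕ)
    (h : ∀ n ∈ S, N < n → ∀ᵐ x ∂ℙ n, x ∈ A n) : WithHighProbability S ℙ A := by
  intro δ h0 h1
  refine ⟨N, fun n hn hlt => ⟨(toMeasurable (ℙ n) (A n)ᶜ)ᶜ, (measurableSet_toMeasurable _ _).compl,
    Set.compl_subset_comm.1 (subset_toMeasurable _ _), ?_⟩⟩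
  rw [probReal_compl_eq_one_sub (measurableSet_toMeasurable _ _), measureReal_def,
    measure_toMeasurable]
  have : ℙ n (A n)ᶜ = 0 := h n hn hlt
  rw [this]
  simpa using h0

lemma WithHighProbability.inter [∀ n, IsProbabilityMeasure (ℙ n)]
    (h : WithHighProbability S ℙ A) (h' : WithHighProbability S ℙ A') :
    WithHighProbability S ℙ (fun n => A n ∩ A' n) := by
  intro δ h0 h1
  obtain ⟨n₁, hn₁⟩ := h (δ / 2) (by linarith) (by linarith)
  obtain ⟨n₂, hn₂⟩ := h' (δ / 2) (by linarith) (by linarith)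
  refine ⟨max n₁ n₂, fun n hn hlt => ?_⟩
  obtain ⟨B₁, hB₁, hBA₁, hδ₁⟩ := hn₁ n hn (lt_of_le_of_lt (le_max_left _ _) hlt)
  obtain ⟨B₂, hB₂, hBA₂, hδ₂⟩ := hn₂ n hn (lt_of_le_of_lt (le_max_right _ _) hlt)
  refine ⟨B₁ ∩ B₂, hB₁.inter hB₂, Set.inter_subset_inter hBA₁ hBA₂, ?_⟩
  have h3 := measureReal_union_add_inter (μ := ℙ n) (s := B₁) hB₂
  have h4 : (ℙ n).real (B₁ ∪ B₂) ≤ 1 := measureReal_le_one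
  linarith

lemma WithHighProbability.finset_forall [∀ n, IsProbabilityMeasure (ℙ n)] {J : Type*}
    {A : J → ∀ n, Set (Ω n)} (T : Finset J) (h : ∀ j ∈ T, WithHighProbability S ℙ (A j)) :
    WithHighProbability S ℙ (fun n => {x | ∀ j ∈ T, x ∈ A j n}) := by
  classical
  induction T using Finset.induction_on with
  | empty => exact .of_ae 0 fun n _ _ => Filter.Eventually.of_forall fun x j hj => by simp at hj
  | insert j T _ ih =>
    refine ((h j (Finset.mem_insert_self _ _)).inter
      (ih fun i hi => h i (Finset.mem_insert_of_mem hi))).mono fun n x hx i hi => ?_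
    rcases Finset.mem_insert.1 hi with rfl | hi
    · exact hx.1
    · exact hx.2 i hi

end WithHighProbability

/-! ### The law of large numbers for contributions -/

instance {k m : ℕ} (μ : Fin k → Measure (Space m)) [∀ i, IsProbabilityMeasure (μ i)]
    (N : Fin k → ℕ) : IsProbabilityMeasure (sampleLaw μ N) := by
  unfold sampleLaw; infer_instance

lemma memLp_of_mem_Icc {m : ℕ} {μ : Measure (Space m)} [IsProbabilityMeasure μ] {f : Space m → ℝ}
    (hf : Measurable f) {t : ℝ} (hft : ∀ x, f x ∈ Set.Icc 0 t) (p : ENNReal) : MemLp f p μ :=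
  MemLp.of_bound hf.aestronglyMeasurable t (Filter.Eventually.of_forall fun x => by
    rw [Real.norm_of_nonneg (hft x).1]; exact (hft x).2)

lemma integral_sampleLaw_sum {k m n : ℕ} (μ : Fin k → Measure (Space m))
    [∀ i, IsProbabilityMeasure (μ i)] {f : Fin k → Space m → ℝ} (hf : ∀ i, Measurable (f i))
    {t : ℝ} (hft : ∀ i x, f i x ∈ Set.Icc 0 t) :
    ∫ x, ∑ i, ∑ l, f i (x ⟨i, l⟩) ∂sampleLaw μ (fun _ => n) = n * ∑ i, ∫ x, f i x ∂μ i := by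
  have hint : ∀ p : SampleIndex (fun _ : Fin k => n),
      Integrable (fun x => f p.1 (x p)) (sampleLaw μ (fun _ => n)) := fun p =>
    integrable_comp_eval (μ := fun p : SampleIndex (fun _ : Fin k => n) => μ p.1)
      (memLp_one_iff_integrable.1 (memLp_of_mem_Icc (hf p.1) (hft p.1) 1))
  rw [integral_finsetSum _ fun i _ => integrable_finsetSum _ fun l _ => hint ⟨i, l⟩,
    Finset.mul_sum]
  refine Finset.sum_congr rfl fun i _ => ?_
  rw [integral_finsetSum _ fun l _ => hint ⟨i, l⟩]
  have : ∀ l : Fin n, ∫ x, f i (x ⟨i, l⟩) ∂sampleLaw μ (fun _ => n) = ∫ x, f i x ∂μ i := fun l =>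
    integral_comp_eval (μ := fun p : SampleIndex (fun _ : Fin k => n) => μ p.1) (i := ⟨i, l⟩)
      (hf i).aestronglyMeasurable
  simp [this]

/-- The weak law of large numbers, from Chebyshev's inequality. -/
lemma whp_abs_sum_sub_lt {k m : ℕ} (S : Set ℕ) (μ : Fin k → Measure (Space m))
    [∀ i, IsProbabilityMeasure (μ i)] {f : Fin k → Space m → ℝ} (hf : ∀ i, Measurable (f i))
    {t : ℝ} (hft : ∀ i x, f i x ∈ Set.Icc 0 t) {ε : ℝ} (hε : 0 < ε) :
    WithHighProbability S (fun n => sampleLaw μ (fun _ => n))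
      (fun n => {x | |∑ i, ∑ l, f i (x ⟨i, l⟩) - n * ∑ i, ∫ x, f i x ∂μ i| < n * ε}) := by
  intro δ h0 _
  set V := ∑ i, ProbabilityTheory.variance (f i) (μ i) with hV
  refine ⟨⌈V / (δ * ε ^ 2)⌉₊, fun n _ hn => ?_⟩
  have hn0 : (0 : ℝ) < n := Nat.cast_pos.2 (by omega)
  have hmeas : Measurable fun x : SampleIndex (fun _ : Fin k => n) → Space m =>
      ∑ i, ∑ l, f i (x ⟨i, l⟩) :=
    Finset.measurable_sum _ fun i _ => Finset.measurable_sum _ fun l _ =>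
      (hf i).comp (measurable_pi_apply _)
  have hset : MeasurableSet {x : SampleIndex (fun _ : Fin k => n) → Space m |
      n * ε ≤ |∑ i, ∑ l, f i (x ⟨i, l⟩) - n * ∑ i, ∫ x, f i x ∂μ i|} :=
    measurableSet_le measurable_const (hmeas.sub_const _).abs
  have hvar : ProbabilityTheory.variance (fun x => ∑ i, ∑ l, f i (x ⟨i, l⟩))
      (sampleLaw μ (fun _ => n)) = n * V := by
    have h1 := ProbabilityTheory.variance_sum_pi
      (μ := fun p : SampleIndex (fun _ : Fin k => n) => μ p.1) (X := fun p => f p.1)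
      fun p => memLp_of_mem_Icc (hf p.1) (hft p.1) 2
    have h2 : (fun x : SampleIndex (fun _ : Fin k => n) → Space m =>
        ∑ i, ∑ l, f i (x ⟨i, l⟩)) = ∑ p, fun x => f p.1 (x p) := by
      funext x
      rw [Finset.sum_apply, Fintype.sum_sigma]
    rw [h2]
    refine h1.trans ?_
    rw [Fintype.sum_sigma]
    simp [hV, Finset.mul_sum]
  have hLp : MemLp (fun x : SampleIndex (fun _ : Fin k => n) → Space m =>
      ∑ i, ∑ l, f i (x ⟨i, l⟩)) 2 (sampleLaw μ (fun _ => n)) :=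
    memLp_finsetSum _ fun i _ => memLp_finsetSum _ fun l _ =>
      (memLp_of_mem_Icc (hf i) (hft i) 2).comp_measurePreserving
        (measurePreserving_eval (fun p : SampleIndex (fun _ : Fin k => n) => μ p.1) ⟨i, l⟩)
  have hcheb := ProbabilityTheory.meas_ge_le_variance_div_sq hLp (mul_pos hn0 hε)
  rw [integral_sampleLaw_sum μ hf hft, hvar] at hcheb
  refine ⟨_, hset.compl, fun x hx => by simpa using hx, ?_⟩
  rw [probReal_compl_eq_one_sub hset]
  have h1 : n * V / (n * ε) ^ 2 < δ := by
    rw [div_lt_iff₀ (by positivity)]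
    have h2 := (Nat.le_ceil _).trans_lt (Nat.cast_lt.2 hn)
    rw [div_lt_iff₀ (by positivity)] at h2
    have := mul_lt_mul_of_pos_left h2 hn0
    linarith
  have h3 : 0 ≤ n * V / (n * ε) ^ 2 := by
    have : 0 ≤ V := Finset.sum_nonneg fun i _ => ProbabilityTheory.variance_nonneg _ _
    positivity
  have h2 := ENNReal.toReal_mono ENNReal.ofReal_ne_top hcheb
  rw [ENNReal.toReal_ofReal h3] at h2
  have h4 := h2.trans_lt h1
  rw [measureReal_def]
  linarith

/-- The expected contribution at `z` of a sample with one point per ball, all prices being `a`. It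
is the limit of the contribution function divided by the sample size. -/
noncomputable def meanContribution {k m : ℕ} (μ : Fin k → Measure (Space m)) (a : ℝ)
    (z : Space m) : ℝ :=
  ∑ i, ∫ x, max (a - dist z x) 0 ∂μ i

lemma max_sub_dist_mem_Icc {m : ℕ} {a : ℝ} (ha : 0 ≤ a) (z x : Space m) :
    max (a - dist z x) 0 ∈ Set.Icc 0 a :=
  ⟨le_max_right _ _, max_le (sub_le_self _ dist_nonneg) ha⟩

lemma measurable_max_sub_dist {m : ℕ} (a : ℝ) (z : Space m) :
    Measurable fun x => max (a - dist z x) 0 := by fun_prop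

lemma integrable_max_sub_dist {m : ℕ} (μ : Measure (Space m)) [IsProbabilityMeasure μ] {a : ℝ}
    (ha : 0 ≤ a) (z : Space m) : Integrable (fun x => max (a - dist z x) 0) μ :=
  memLp_one_iff_integrable.1
    (memLp_of_mem_Icc (measurable_max_sub_dist a z) (max_sub_dist_mem_Icc ha z) 1)

lemma G_one_eq_meanContribution {k m : ℕ} (μ : Fin k → Measure (Space m))
    [∀ i, IsProbabilityMeasure (μ i)] {a : ℝ} (ha : 0 ≤ a) (z : Space m) :
    G μ 1 (fun _ => 1) (fun _ => a) z = meanContribution μ a z := by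
  have := integral_sampleLaw_sum (n := 1) μ (f := fun _ x => max (a - dist z x) 0)
    (fun _ => measurable_max_sub_dist a z) (fun _ => max_sub_dist_mem_Icc ha z)
  simpa [G, contribution, meanContribution] using this

lemma meanContribution_le_add {k m : ℕ} (μ : Fin k → Measure (Space m))
    [∀ i, IsProbabilityMeasure (μ i)] {a : ℝ} (ha : 0 ≤ a) (z w : Space m) :
    meanContribution μ a z ≤ meanContribution μ a w + k * dist z w := by
  have : (k : ℝ) * dist z w = ∑ _i : Fin k, dist z w := by simp
  rw [this, meanContribution, meanContribution, ← Finset.sum_add_distrib]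
  refine Finset.sum_le_sum fun i _ => ?_
  have h1 : ∫ x, (max (a - dist w x) 0 + dist z w) ∂μ i =
      ∫ x, max (a - dist w x) 0 ∂μ i + dist z w := by
    rw [integral_add (integrable_max_sub_dist _ ha w) (integrable_const _)]
    simp
  rw [← h1]
  refine integral_mono (integrable_max_sub_dist _ ha z)
    ((integrable_max_sub_dist _ ha w).add (integrable_const _)) fun x =>
    max_sub_zero_le_add ?_ dist_nonneg
  linarith [dist_triangle_left w x z]

lemma continuous_meanContribution {k m : ℕ} (μ : Fin k → Measure (Space m))
    [∀ i, IsProbabilityMeasure (μ i)] {a : ℝ} (ha : 0 ≤ a) :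
    Continuous (meanContribution μ a) :=
  (LipschitzWith.of_le_add_mul k fun z w => meanContribution_le_add μ ha z w).continuous

/-- The law of large numbers for the contribution function, uniformly on a compact set: both sides
are Lipschitz in `z`, so that a finite net suffices. -/
lemma whp_contribution_close {k m : ℕ} (S : Set ℕ) (μ : Fin k → Measure (Space m))
    [∀ i, IsProbabilityMeasure (μ i)] {a : ℝ} (ha : 0 ≤ a) {K : Set (Space m)} (hK : IsCompact K)
    {ε : ℝ} (hε : 0 < ε) :
    WithHighProbability S (fun n => sampleLaw μ (fun _ => n)) (fun n =>
      {x | ∀ z ∈ K, |contribution (fun _ => a) x z - n * meanContribution μ a z| ≤ n * ε}) := by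
  have hρ : 0 < ε / (4 * (k + 1)) := by positivity
  obtain ⟨T, -, hT, hcover⟩ := hK.finite_cover_balls hρ
  have hkρ : 2 * (k * (ε / (4 * (k + 1)))) ≤ ε / 2 := by
    rw [← mul_assoc, mul_div_assoc', div_le_iff₀ (by positivity)]
    nlinarith
  set ρ := ε / (4 * (k + 1))
  refine (WithHighProbability.finset_forall hT.toFinset fun w _ =>
    whp_abs_sum_sub_lt S μ (f := fun _ x => max (a - dist w x) 0)
      (fun _ => measurable_max_sub_dist a w) (fun _ => max_sub_dist_mem_Icc ha w)
      (half_pos hε)).mono fun n x hx z hz => ?_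
  obtain ⟨w, hw, hzw⟩ := Set.mem_iUnion₂.1 (hcover hz)
  have h1 := hx w (hT.mem_toFinset.2 hw)
  rw [Set.mem_ofPred_eq, abs_lt] at h1
  change -_ < contribution (fun _ => a) x w - n * meanContribution μ a w ∧
    contribution (fun _ => a) x w - n * meanContribution μ a w < _ at h1
  have h2 : dist z w ≤ ρ := (mem_ball.1 hzw).le
  have h3 := contribution_le_add x (a := fun _ => a) (b := fun _ => a) (z := z) (w := w) (e := ρ)
    (fun _ => by linarith) hρ.le
  have h4 := contribution_le_add x (a := fun _ => a) (b := fun _ => a) (z := w) (w := z) (e := ρ)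
    (fun _ => by rw [dist_comm]; linarith) hρ.le
  have hk : (k : ℝ) * dist z w ≤ k * ρ := mul_le_mul_of_nonneg_left h2 (Nat.cast_nonneg _)
  have h5 := meanContribution_le_add μ ha z w
  have h6 := meanContribution_le_add μ ha w z
  rw [dist_comm w z] at h6
  have hn : (0 : ℝ) ≤ n := Nat.cast_nonneg _
  have h7 := mul_le_mul_of_nonneg_left (h5.trans (add_le_add_right hk _)) hn
  have h8 := mul_le_mul_of_nonneg_left (h6.trans (add_le_add_right hk _)) hn
  have h9 := mul_le_mul_of_nonneg_left hkρ hn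
  rw [abs_le]
  constructor <;> linarith

lemma whp_exists_dist_le {k m : ℕ} (S : Set ℕ) (μ : Fin k → Measure (Space m))
    [∀ i, IsProbabilityMeasure (μ i)] (c : Fin k → Space m) (i : Fin k)
    (hopen : PositiveNearCenter (μ i) (c i) 1) {ε : ℝ} (hε : 0 < ε) :
    WithHighProbability S (fun n => sampleLaw μ (fun _ => n))
      (fun _ => {x | ∃ l, dist (x ⟨i, l⟩) (c i) ≤ ε}) := by
  have hpos : 0 < ∫ x, max (ε - dist (c i) x) 0 ∂μ i := by
    refine (integral_pos_iff_support_of_nonneg (fun x => le_max_right _ _)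
      (integrable_max_sub_dist _ hε.le _)).2 ?_
    refine (hopen (ball (c i) ε) isOpen_ball (mem_ball_self hε)).trans_le (measure_mono ?_)
    rintro x ⟨hx, -⟩
    have := mem_ball'.1 hx
    exact (lt_max_of_lt_left (by linarith)).ne'
  refine (whp_abs_sum_sub_lt S μ (f := fun j x => if j = i then max (ε - dist (c i) x) 0 else 0)
    (t := ε) ?_ ?_ hpos).mono fun _ x hx => ?_
  · intro j
    by_cases h : j = i
    · simpa only [if_pos h] using measurable_max_sub_dist ε (c i)
    · simp only [if_neg h, measurable_const]
  · intro j x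
    by_cases h : j = i
    · simpa only [if_pos h] using max_sub_dist_mem_Icc hε.le (c i) x
    · simpa only [if_neg h] using Set.left_mem_Icc.2 hε.le
  · have h1 := hx
    rw [Set.mem_ofPred_eq, Finset.sum_eq_single i, Finset.sum_eq_single i] at h1
    · simp only [if_true] at h1
      by_contra h
      simp only [Set.mem_ofPred_eq, not_exists, not_le] at h
      have h2 : ∑ l, max (ε - dist (c i) (x ⟨i, l⟩)) 0 = 0 :=
        Finset.sum_eq_zero fun l _ => max_eq_right (by rw [dist_comm]; linarith [h l])
      rw [h2] at h1
      linarith [(abs_lt.1 h1).1]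
    · intro j _ hj; simp [hj]
    · simp
    · intro j _ hj; simp [hj]
    · simp

lemma ae_sampleLaw_mem_closedBall {k m : ℕ} {μ : Fin k → Measure (Space m)}
    [∀ i, IsProbabilityMeasure (μ i)] {c : Fin k → Space m}
    (hμ : ∀ i, IsBallMeasure (μ i) (c i) 1) (n : ℕ) :
    ∀ᵐ x ∂sampleLaw μ (fun _ => n), ∀ p, x p ∈ closedBall (c p.1) 1 :=
  ae_all_iff.2 fun p =>
    (measurePreserving_eval (fun p : SampleIndex (fun _ : Fin k => n) => μ p.1)
      p).quasiMeasurePreserving.ae (p := fun y => y ∈ closedBall (c p.1) 1) (hμ p.1).supported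

/-- At the center of ball `i` only that ball contributes, and it contributes fully. -/
lemma meanContribution_center {k m : ℕ} {μ : Fin k → Measure (Space m)} {c : Fin k → Space m}
    (hμ : ∀ i, IsBallMeasure (μ i) (c i) 1) {a : ℝ} (ha : 1 ≤ a)
    (hsep : ∀ i j, i ≠ j → a ≤ dist (c i) (c j) - 1) (i : Fin k) :
    meanContribution μ a (c i) = a - meanDist (μ i) (c i) := by
  have := fun i => (hμ i).prob
  have hball : ∀ j, ∀ᵐ x ∂μ j, x ∈ closedBall (c j) 1 := fun j => (hμ j).supported
  rw [meanContribution, Finset.sum_eq_single i]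
  · have h1 : (fun x => max (a - dist (c i) x) 0) =ᵐ[μ i] fun x => a - dist x (c i) := by
      filter_upwards [hball i] with x hx
      rw [dist_comm, max_eq_left]
      linarith [mem_closedBall.1 hx]
    have h2 : Integrable (fun x => dist x (c i)) (μ i) := by
      refine Integrable.of_bound (by fun_prop) 1 ?_
      filter_upwards [hball i] with x hx
      rw [Real.norm_of_nonneg dist_nonneg]
      exact hx
    rw [integral_congr_ae h1, integral_sub (integrable_const _) h2, meanDist]
    simp
  · intro j _ hj
    refine integral_eq_zero_of_ae ?_
    filter_upwards [hball j] with x hx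
    refine max_eq_right ?_
    have h1 := dist_triangle (c i) x (c j)
    linarith [mem_closedBall.1 hx, hsep i j hj.symm]
  · simp

lemma exists_gap_of_unique_max {m : ℕ} {g : Space m → ℝ} (hg : Continuous g) {c : Space m}
    {G₀ τ : ℝ} (h : ∀ z ∈ closedBall c 1, z ≠ c → g z < G₀) (hτ : 0 < τ) :
    ∃ η > 0, ∀ z ∈ closedBall c 1, τ ≤ dist z c → g z ≤ G₀ - η := by
  have hK : IsCompact (closedBall c 1 ∩ {z | τ ≤ dist z c}) :=
    (isCompact_closedBall c 1).inter_right (isClosed_le continuous_const (by fun_prop))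
  rcases (closedBall c 1 ∩ {z | τ ≤ dist z c}).eq_empty_or_nonempty with he | hne
  · exact ⟨1, one_pos, fun z hz hτz => absurd (show z ∈ (∅ : Set _) from he ▸ ⟨hz, hτz⟩) id⟩
  · obtain ⟨w, ⟨hw, hτw⟩, hmax⟩ := hK.exists_isMaxOn hne hg.continuousOn
    refine ⟨G₀ - g w, sub_pos.2 (h w hw ?_), fun z hz hτz => ?_⟩
    · rintro rfl
      rw [Set.mem_ofPred_eq, dist_self] at hτw
      linarith
    · rw [sub_sub_cancel]
      exact hmax ⟨hz, hτz⟩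

end KMedian

theorem mainTheorem3 (k m : ℕ) (hm : 1 ≤ m)
    (c : Fin k → KMedian.Space m)
    (μ : Fin k → MeasureTheory.Measure (KMedian.Space m))
    (hμ : ∀ i, KMedian.IsBallMeasure (μ i) (c i) 1)
    (hrot : ∀ i, KMedian.RotationInvariant (μ i) (c i))
    (hopen : ∀ i, KMedian.PositiveNearCenter (μ i) (c i) 1)
    (hdim : ∀ i, KMedian.NullOnLebesgueNull (μ i) (c i) 1)
    (hE : ∀ i j, KMedian.meanDist (μ i) (c i) = KMedian.meanDist (μ j) (c j))
    (α' : ℝ) (hα' : 1 < α') (hsep : ∀ i j, i ≠ j → α' < dist (c i) (c j) - 1)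
    (hG : ∀ n : ℕ, 1 ≤ n → ∀ i, KMedian.IsUniqueMax
      (KMedian.G μ n (fun _ => n) (fun _ => α')) (Metric.closedBall (c i) 1) (c i)) :
    KMedian.WithHighProbability {n : ℕ | m = 1 → Odd n}
      (fun n => KMedian.sampleLaw μ (fun _ => n))
      (fun n => {x | KMedian.ExactRecovery
        (fun p : KMedian.SampleIndex (fun _ : Fin k => n) => p.1) x}) := by
  open KMedian Filter Topology in
  have := fun i => (hμ i).prob
  have hα0 : 0 ≤ α' := by linarith
  set g := meanContribution μ α' with hgdef
  have hcenter := meanContribution_center hμ hα'.le fun i j hij => (hsep i j hij).le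
  obtain ⟨G₀, hG₀⟩ : ∃ G₀, ∀ i, g (c i) = G₀ := by
    rcases isEmpty_or_nonempty (Fin k) with h | ⟨⟨i₀⟩⟩
    · exact ⟨0, fun i => h.elim i⟩
    · exact ⟨g (c i₀), fun i => by rw [hgdef, hcenter, hcenter, hE i i₀]⟩
  have hGg : G μ 1 (fun _ => 1) (fun _ => α') = g :=
    funext (G_one_eq_meanContribution μ hα0)
  have hmax := hG 1 le_rfl
  rw [hGg] at hmax
  have hle : ∀ i, ∀ z ∈ closedBall (c i) 1, g z ≤ G₀ := fun i z hz =>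
    hG₀ i ▸ (hmax i).2.1 z hz
  have hlt : ∀ i, ∀ z ∈ closedBall (c i) 1, z ≠ c i → g z < G₀ := by
    intro i z hz hne
    by_contra! h
    exact hne ((hmax i).2.2 z hz fun w hw => (hle i w hw).trans h)
  have hsmall : ∀ s : ℝ, 0 < s → ∀ᶠ τ in 𝓝[>] (0 : ℝ), τ < s := fun s hs =>
    mem_of_superset (Ioo_mem_nhdsGT hs) fun τ h => h.2
  obtain ⟨τ, hτ0, hτα, hτsep⟩ : ∃ τ > 0, 1 + 2 * τ ≤ α' ∧
      ∀ i j, i ≠ j → α' + 2 * τ ≤ dist (c i) (c j) - 1 := by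
    have h1 : ∀ᶠ τ in 𝓝[>] (0 : ℝ), ∀ i j, i ≠ j → α' + 2 * τ ≤ dist (c i) (c j) - 1 := by
      refine eventually_all.2 fun i => eventually_all.2 fun j => ?_
      by_cases hij : i = j
      · exact Eventually.of_forall fun τ h => absurd hij h
      · filter_upwards [hsmall ((dist (c i) (c j) - 1 - α') / 2)
          (by linarith [hsep i j hij])] with τ hτ _
        linarith
    obtain ⟨τ, h1, h2, h3⟩ := (h1.and ((hsmall ((α' - 1) / 2) (by linarith)).and
      (eventually_mem_nhdsWithin (a := (0 : ℝ)) (s := Set.Ioi 0)))).exists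
    exact ⟨τ, h3, by linarith, h1⟩
  obtain ⟨η, hη0, hη⟩ : ∃ η > 0, ∀ i, ∀ z ∈ closedBall (c i) 1, τ ≤ dist z (c i) →
      g z ≤ G₀ - η := by
    have h1 : ∀ᶠ η in 𝓝[>] (0 : ℝ), ∀ i, ∀ z ∈ closedBall (c i) 1, τ ≤ dist z (c i) →
        g z ≤ G₀ - η := by
      refine eventually_all.2 fun i => ?_
      obtain ⟨η, hη0, hη⟩ :=
        exists_gap_of_unique_max (continuous_meanContribution μ hα0) (hlt i) hτ0
      filter_upwards [hsmall η hη0] with η' h z hz hz'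
      exact (hη z hz hz').trans (by linarith)
    obtain ⟨η, h1, h2⟩ := (h1.and
      (eventually_mem_nhdsWithin (a := (0 : ℝ)) (s := Set.Ioi 0))).exists
    exact ⟨η, h2, h1⟩
  obtain ⟨ε, ⟨h1, h2⟩, hε0⟩ := (((hsmall (τ / 2) (by linarith)).and
    (hsmall (η / (2 * k + 1)) (by positivity))).and
    (eventually_mem_nhdsWithin (a := (0 : ℝ)) (s := Set.Ioi 0))).exists
  have hετ : 2 * ε ≤ τ := by linarith
  have hεη : (2 * k + 1) * ε < η := by
    rw [lt_div_iff₀ (by positivity)] at h2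
    linarith
  have hac := fun i => absolutelyContinuous_volume (hμ i) (hdim i)
  have hgood : WithHighProbability {n : ℕ | m = 1 → Odd n} (fun n => sampleLaw μ (fun _ => n))
      (fun n => {x | 0 < n ∧ (∀ p, x p ∈ closedBall (c p.1) 1) ∧ HasUniqueMedoids x}) := by
    refine .of_ae 2 fun n hn hlt => ?_
    have hu : ∀ᵐ x ∂sampleLaw μ (fun _ => n), HasUniqueMedoids x := by
      rcases hm.eq_or_lt with rfl | hm
      · exact ae_hasUniqueMedoids_of_odd μ hac (hn rfl)
      · exact ae_hasUniqueMedoids_of_two_le hm μ hac hlt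
    filter_upwards [hu, ae_sampleLaw_mem_closedBall hμ n] with x h1 h2
    exact ⟨by omega, h2, h1⟩
  have hclose := whp_contribution_close {n : ℕ | m = 1 → Odd n} μ hα0
    (isCompact_iUnion fun i => isCompact_closedBall (c i) 1) hε0
  have hnear := WithHighProbability.finset_forall Finset.univ fun i _ =>
    whp_exists_dist_le {n : ℕ | m = 1 → Odd n} μ c i (hopen i) hε0
  refine (hgood.inter (hclose.inter hnear)).mono ?_
  rintro n x ⟨⟨hn, hx, hu⟩, hcl, hnr⟩
  exact exactRecovery_of_contribution_close hn c g hε0 hτα hετ hτsep hεη hG₀ hle hη x hx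
    (fun i z hz => hcl z (Set.mem_iUnion.2 ⟨i, hz⟩)) (fun i => hnr i (Finset.mem_univ i)) hu
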